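/- **Theorem (Local strong convexity).** Let $d\ge 1$, put $\tilde d=\lceil\frac{d+1}{2}\rceil$, and let $f\in\mathbb{R}[x]$ be a polynomial of degree $d$ with parity $d \bmod 2$ (that is, $f(-x)=(-1)^d f(x)$) and $\|f\|_\infty:=\max_{x\in[-1,1]}|f(x)|<1$. For $\Phi=(\phi_0,\dots,\phi_d)\in\mathbb{R}^{d+1}$ and $x\in[-1,1]$ let $$U(x,\Phi)=e^{\mathrm{i}\phi_0Z}e^{\mathrm{i}\arccos(x)X}e^{\mathrm{i}\phi_1Z}e^{\mathrm{i}\arccos(x)X}\cdots e^{\mathrm{i}\phi_{d-1}Z}e^{\mathrm{i}\arccos(x)X}e^{\mathrm{i}\phi_dZ},\qquad X=\begin{pmatrix}0&1\\1&0\end{pmatrix},\quad Z=\begin{pmatrix}1&0\\0&-1\end{pmatrix},$$ let $g(x,\Phi)$ be the real part of the upper-left entry of $U(x,\Phi)$, and let $$F(\Phi)=\frac1{\tilde d}\sum_{k=1}^{\tilde d}\left|g(x_k,\Phi)-f(x_k)\right|^2,\qquad x_k=\cos\left(\frac{2k-1}{4\tilde d}\pi\right).$$ Call $\Phi$ symmetric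 if $\phi_{d-i}=\phi_i$ for all $i$. A symmetric $\Phi$ is determined by its reduced phase factors $\tilde\Phi=(\phi_0,\dots,\phi_{\tilde d-1})\in\mathbb{R}^{\tilde d}$. On symmetric phase factors $F$ is regarded as a function $F(\tilde\Phi)$ of $\tilde\Phi\in\mathbb{R}^{\tilde d}$, and $\mathrm{Hess}(\tilde\Phi)\in\mathbb{R}^{\tilde d\times\tilde d}$ denotes its Hessian matrix. Let $\Phi^0=(\frac{\pi}{4},0,\dots,0,\frac{\pi}{4})\in\mathbb{R}^{d+1}$, with reduced phase factors $\tilde\Phi^0$. Suppose that $\|f\|_\infty\le\frac{\sqrt3}{20\pi\tilde d}$. Then for every symmetric $\Phi\in\mathbb{R}^{d+1}$ with $\|\tilde\Phi-\tilde\Phi^0\|_2\le\frac1{20\tilde d}$, the matrix $\mathrm{Hess}(\tilde\Phi)$ is symmetric and its smallest and largest eigenvalues satisfy $$\frac14\le\lambda_{\min}\left(\mathrm{Hess}(\tilde\Phi)\right)\le\lambda_{\max}\left(\mathrm{Hess}(\tilde\Phi)\right)\le\frac{25}{4}.$$ -/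

import Mathlib

open scoped BigOperators Polynomial

namespace SymmetricQSP

noncomputable section

/-! ### Target polynomials -/

/-- The maximum norm `‖f‖_∞ = max_{x ∈ [-1,1]} |f x|` of a real polynomial. -/
def maxNorm (f : ℝ[X]) : ℝ :=
  sSup ((fun x : ℝ => |f.eval x|) '' Set.Icc (-1) 1)

/-- Target polynomials: degree `d`, parity `d mod 2`, and maximum norm less than one. -/
structure IsTarget (d : ℕ) (f : ℝ[X]) : Prop where
  degree_eq : f.degree = (d : WithBot ℕ)
  parity : ∀ x : ℝ, f.eval (-x) = (-1) ^ d * f.eval x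
  maxNorm_lt_one : maxNorm f < 1

/-! ### The unitary matrix and the function `g` -/

/-- The Pauli matrix `X`. -/
def pauliX : Matrix (Fin 2) (Fin 2) ℂ := !![0, 1; 1, 0]

/-- The Pauli matrix `Z`. -/
def pauliZ : Matrix (Fin 2) (Fin 2) ℂ := !![1, 0; 0, -1]

/-- The phase rotation `e^{i φ Z}`. -/
def phaseZ (φ : ℝ) : Matrix (Fin 2) (Fin 2) ℂ :=
  NormedSpace.exp ((Complex.I * (φ : ℂ)) • pauliZ)

/-- The signal matrix `e^{i arccos(x) X}`. -/
def signalW (x : ℝ) : Matrix (Fin 2) (Fin 2) ℂ :=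
  NormedSpace.exp ((Complex.I * (Real.arccos x : ℂ)) • pauliX)

/-- The ordered product
`e^{i φ_0 Z} e^{i arccos(x) X} e^{i φ_1 Z} e^{i arccos(x) X} ⋯ e^{i arccos(x) X} e^{i φ_d Z}`. -/
def unitary {d : ℕ} (x : ℝ) (Φ : Fin (d + 1) → ℝ) : Matrix (Fin 2) (Fin 2) ℂ :=
  phaseZ (Φ 0) * (List.ofFn fun j : Fin d => signalW x * phaseZ (Φ j.succ)).prod

/-- The real part of the upper-left entry of the unitary matrix. -/
def g {d : ℕ} (x : ℝ) (Φ : Fin (d + 1) → ℝ) : ℝ :=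
  (unitary x Φ 0 0).re

/-! ### Symmetric and reduced phase factors -/

/-- The number `⌈(d + 1) / 2⌉` of reduced phase factors. -/
def redLen (d : ℕ) : ℕ := d / 2 + 1

theorem redLen_eq_ceil (d : ℕ) : redLen d = ⌈((d : ℝ) + 1) / 2⌉₊ := by
  symm
  rw [Nat.ceil_eq_iff (by simp [redLen])]
  have h1 : 2 * (d / 2) ≤ d := by omega
  have h2 : d ≤ 2 * (d / 2) + 1 := by omega
  have h1' : (2 : ℝ) * ((d / 2 : ℕ) : ℝ) ≤ d := by exact_mod_cast h1
  have h2' : (d : ℝ) ≤ 2 * ((d / 2 : ℕ) : ℝ) + 1 := by exact_mod_cast h2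
  constructor
  · simp only [redLen, Nat.add_sub_cancel]; linarith
  · simp only [redLen]; push_cast at *; linarith

/-- Symmetric phase factors: `φ_{d-i} = φ_i` for all `i`. -/
def IsSymmetric {d : ℕ} (Φ : Fin (d + 1) → ℝ) : Prop :=
  ∀ i : Fin (d + 1), Φ i.rev = Φ i

theorem lt_of_redLen {d j : ℕ} (hd : j < redLen d) : j < d + 1 := by
  unfold redLen at hd; omega

theorem min_lt_redLen {d : ℕ} (i : Fin (d + 1)) : min (i : ℕ) (d - i) < redLen d := by
  unfold redLen; omega

/-- The reduced phase factors: the left half `(φ_0, …, φ_{d̃-1})` of `Φ`, where `d̃ = redLen d`. -/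
def reduced {d : ℕ} (Φ : Fin (d + 1) → ℝ) : EuclideanSpace ℝ (Fin (redLen d)) :=
  WithLp.toLp 2 fun j => Φ ⟨j, lt_of_redLen j.isLt⟩

/-- The symmetric phase factors of length `d + 1` determined by reduced phase factors. -/
def unreduced {d : ℕ} (φ : EuclideanSpace ℝ (Fin (redLen d))) : Fin (d + 1) → ℝ :=
  fun i => φ ⟨min (i : ℕ) (d - i), min_lt_redLen i⟩

theorem unreduced_reduced {d : ℕ} {Φ : Fin (d + 1) → ℝ} (h : IsSymmetric Φ) :
    unreduced (reduced Φ) = Φ := by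
  funext i
  rcases le_total (i : ℕ) (d - i) with hi | hi
  · simp [unreduced, reduced, min_eq_left hi]
  · rw [← h i]
    simp only [unreduced, reduced, min_eq_right hi]
    congr 1
    ext
    simp [Fin.val_rev]

/-- The initial guess `Φ⁰ = (π/4, 0, …, 0, π/4)`. -/
def initialPhase (d : ℕ) : Fin (d + 1) → ℝ :=
  fun i => if i = 0 ∨ i = Fin.last d then Real.pi / 4 else 0

/-! ### The cost function and its Hessian -/

/-- The node `x_k = cos((2k - 1)π / (4 d̃))`, for `k = 1, …, d̃`, where `d̃ = redLen d`. -/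
def node (d k : ℕ) : ℝ :=
  Real.cos ((2 * (k : ℝ) - 1) / (4 * (redLen d : ℝ)) * Real.pi)

/-- The cost function, as a function of all the phase factors. -/
def fullCost {d : ℕ} (f : ℝ[X]) (Φ : Fin (d + 1) → ℝ) : ℝ :=
  1 / (redLen d : ℝ) *
    ∑ k ∈ Finset.Icc 1 (redLen d), |g (node d k) Φ - f.eval (node d k)| ^ 2

/-- The cost function, as a function of the reduced phase factors. -/
def cost {d : ℕ} (f : ℝ[X]) (φ : EuclideanSpace ℝ (Fin (redLen d))) : ℝ :=
  fullCost f (unreduced φ)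

/-- The partial derivative of `F` with respect to the `i`-th coordinate. -/
def partialDeriv {n : ℕ} (i : Fin n) (F : EuclideanSpace ℝ (Fin n) → ℝ)
    (φ : EuclideanSpace ℝ (Fin n)) : ℝ :=
  lineDeriv ℝ F φ (EuclideanSpace.single i 1)

/-- The Hessian matrix, with entries `∂_j ∂_i F`. -/
def hessian {n : ℕ} (F : EuclideanSpace ℝ (Fin n) → ℝ) (φ : EuclideanSpace ℝ (Fin n)) :
    Matrix (Fin n) (Fin n) ℝ :=
  Matrix.of fun i j => partialDeriv j (partialDeriv i F) φ

/-- The smallest eigenvalue of a real symmetric matrix (of positive size). -/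
def lambdaMin {n : ℕ} {A : Matrix (Fin n) (Fin n) ℝ} (hA : A.IsHermitian) : ℝ :=
  ⨅ i, hA.eigenvalues i

/-- The largest eigenvalue of a real symmetric matrix (of positive size). -/
def lambdaMax {n : ℕ} {A : Matrix (Fin n) (Fin n) ℝ} (hA : A.IsHermitian) : ℝ :=
  ⨆ i, hA.eigenvalues i

end

end SymmetricQSP

namespace SymmetricQSP

/-! ### Closed forms of the rotations -/

/-! Differentiating $e^{i\phi Z}$ in $\phi$ only shifts $\phi$ by $\pi/2$. So every partial
derivative of $g$ is a value of $g$ at shifted phases, hence at most 1 in modulus by unitarity, and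
derivatives along $V,W$ are bounded by products of $\ell^1$ norms.

The quadratic form of the Hessian is $\frac2{\tilde d}\sum_k\big[(D_Vg)^2+(g-f)D^2_{V,V}g\big](x_k)$
(`hessian_cost_quadForm`), where $V$ is the symmetric extension of $v$. At $\Phi^0$, $g$ vanishes
and $\partial_jg=-\cos((2j-d)\arccos x)$; orthogonality of these cosines at the nodes gives
$\sum_k(D_Vg)^2=\tilde d\sum_jV_j^2$ (`sum_sq_dirDeriv_initialPhase`), which lies between $\tilde
d\|v\|^2$ and $2\tilde d\|v\|^2$. So the first term contributes between 2 and 4 for unit $v$.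

Within the ball, $D_Vg$ moves by at most $1/5$. Since $|D^2_{V,V}g|\le4\tilde d$, the second term is
controlled by the summed residuals, which `sum_abs_g_sub_eval_le` makes small. The bounds $1/4$ and
$25/4$ survive these errors. -/

theorem phaseZ_eq (φ : ℝ) :
    phaseZ φ = !![Complex.exp (Complex.I * φ), 0; 0, Complex.exp (-(Complex.I * φ))] := by
  have h : (Complex.I * (φ : ℂ)) • pauliZ =
      Matrix.diagonal ![Complex.I * φ, -(Complex.I * φ)] := by
    ext i j
    fin_cases i <;> fin_cases j <;> simp [pauliZ]
  rw [phaseZ, h, Matrix.exp_diagonal]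
  ext i j
  fin_cases i <;> fin_cases j <;> simp [Pi.coe_exp, ← Complex.exp_eq_exp_ℂ]

/-- The rotation `e^{i θ X}` in closed form. -/
noncomputable def rotX (θ : ℝ) : Matrix (Fin 2) (Fin 2) ℂ :=
  !![(Real.cos θ : ℂ), Complex.I * Real.sin θ; Complex.I * Real.sin θ, (Real.cos θ : ℂ)]

theorem signalW_eq (x : ℝ) : signalW x = rotX (Real.arccos x) := by
  set θ := Real.arccos x
  -- The unnormalised Hadamard matrix conjugates $Z$ into $X$, reducing to the diagonal exponential.
  let H : Matrix (Fin 2) (Fin 2) ℂ := !![1, 1; 1, -1]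
  have hH : H * ((1 / 2 : ℂ) • H) = 1 := by
    ext i j
    fin_cases i <;> fin_cases j <;> norm_num [H, Matrix.mul_apply, Fin.sum_univ_two]
  have hinv : H⁻¹ = (1 / 2 : ℂ) • H := Matrix.inv_eq_right_inv hH
  have hu : IsUnit H := IsUnit.of_mul_eq_one _ hH
  have hX : (Complex.I * (θ : ℂ)) • pauliX = H * ((Complex.I * (θ : ℂ)) • pauliZ) * H⁻¹ := by
    rw [hinv]
    ext i j
    fin_cases i <;> fin_cases j <;>
      simp [H, pauliX, pauliZ, Matrix.mul_apply, Fin.sum_univ_two] <;> ring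
  have := phaseZ_eq θ
  rw [phaseZ] at this
  rw [signalW, hX, Matrix.exp_conj _ _ hu, this, hinv, rotX]
  have e1 : Complex.exp (Complex.I * θ) = Complex.cos θ + Complex.sin θ * Complex.I := by
    rw [mul_comm, Complex.exp_mul_I]
  have e2 : Complex.exp (-(Complex.I * θ)) = Complex.cos θ - Complex.sin θ * Complex.I := by
    rw [mul_comm, ← neg_mul, Complex.exp_mul_I, Complex.cos_neg, Complex.sin_neg]; ring
  ext i j
  fin_cases i <;> fin_cases j <;>
    simp [H, Matrix.mul_apply, Fin.sum_univ_two, e1, e2] <;> ring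

theorem rotX_mul (a b : ℝ) : rotX a * rotX b = rotX (a + b) := by
  have hI : Complex.I ^ 2 = -1 := Complex.I_sq
  ext i j
  fin_cases i <;> fin_cases j <;>
    simp [rotX, Matrix.mul_apply, Fin.sum_univ_two, Complex.cos_add, Complex.sin_add] <;>
    first | ring1 | linear_combination (Complex.sin a * Complex.sin b) * hI

theorem rotX_zero : rotX 0 = 1 := by
  ext i j
  fin_cases i <;> fin_cases j <;> simp [rotX]

theorem phaseZ_add (a b : ℝ) : phaseZ (a + b) = phaseZ a * phaseZ b := by
  simp only [phaseZ_eq]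
  ext i j
  fin_cases i <;> fin_cases j <;>
    simp [Matrix.mul_apply, Fin.sum_univ_two, ← Complex.exp_add] <;> ring_nf

theorem phaseZ_zero : phaseZ 0 = 1 := by
  rw [phaseZ_eq]
  ext i j
  fin_cases i <;> fin_cases j <;> simp

theorem phaseZ_mem_unitaryGroup (φ : ℝ) : phaseZ φ ∈ Matrix.unitaryGroup (Fin 2) ℂ := by
  have h : star (phaseZ φ) = phaseZ (-φ) := by
    simp only [phaseZ_eq]
    ext i j
    fin_cases i <;> fin_cases j <;> simp [Matrix.star_apply, ← Complex.exp_conj]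
  rw [Matrix.mem_unitaryGroup_iff, h, ← phaseZ_add, add_neg_cancel, phaseZ_zero]

theorem signalW_mem_unitaryGroup (x : ℝ) : signalW x ∈ Matrix.unitaryGroup (Fin 2) ℂ := by
  have h (θ : ℝ) : star (rotX θ) = rotX (-θ) := by
    ext i j
    fin_cases i <;> fin_cases j <;>
      simp [rotX, Matrix.star_apply, ← Complex.cos_conj, ← Complex.sin_conj]
  rw [Matrix.mem_unitaryGroup_iff, signalW_eq, h, rotX_mul, add_neg_cancel, rotX_zero]

/-! ### Structure of the unitary matrix -/

theorem unitary_zero (x : ℝ) (Φ : Fin (0 + 1) → ℝ) : unitary x Φ = phaseZ (Φ 0) := by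
  simp [unitary]

theorem unitary_succ {d : ℕ} (x : ℝ) (Φ : Fin (d + 1 + 1) → ℝ) :
    unitary x Φ = phaseZ (Φ 0) * (signalW x * unitary x (Fin.tail Φ)) := by
  simp [unitary, List.ofFn_succ, Fin.tail, mul_assoc]

theorem unitary_mem_unitaryGroup (x : ℝ) : ∀ {d : ℕ} (Φ : Fin (d + 1) → ℝ),
    unitary x Φ ∈ Matrix.unitaryGroup (Fin 2) ℂ
  | 0, Φ => by rw [unitary_zero]; exact phaseZ_mem_unitaryGroup _
  | d + 1, Φ => by
    rw [unitary_succ]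
    exact mul_mem (phaseZ_mem_unitaryGroup _)
      (mul_mem (signalW_mem_unitaryGroup _) (unitary_mem_unitaryGroup x _))

theorem abs_g_le_one {d : ℕ} (x : ℝ) (Φ : Fin (d + 1) → ℝ) : |g x Φ| ≤ 1 :=
  (Complex.abs_re_le_norm _).trans (entry_norm_bound_of_unitary (unitary_mem_unitaryGroup x Φ) 0 0)

theorem tail_add_single_zero {d : ℕ} (Φ : Fin (d + 1 + 1) → ℝ) (a : ℝ) :
    Fin.tail (Φ + Pi.single 0 a) = Fin.tail Φ := by
  funext i
  simp [Fin.tail, Fin.succ_ne_zero]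

theorem tail_add_single_succ {d : ℕ} (Φ : Fin (d + 1 + 1) → ℝ) (j : Fin (d + 1)) (a : ℝ) :
    Fin.tail (Φ + Pi.single j.succ a) = Fin.tail Φ + Pi.single j a := by
  funext i
  simp [Fin.tail, Pi.single_apply]

theorem unitary_add_single_zero (x a : ℝ) : ∀ {d : ℕ} (Φ : Fin (d + 1) → ℝ),
    unitary x (Φ + Pi.single 0 a) = phaseZ a * unitary x Φ
  | 0, Φ => by simp [unitary_zero, add_comm _ a, phaseZ_add]
  | d + 1, Φ => by
    rw [unitary_succ, unitary_succ, tail_add_single_zero]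
    simp [add_comm _ a, phaseZ_add, mul_assoc]

theorem unitary_add_single_last (x a : ℝ) : ∀ {d : ℕ} (Φ : Fin (d + 1) → ℝ),
    unitary x (Φ + Pi.single (Fin.last d) a) = unitary x Φ * phaseZ a
  | 0, Φ => by simp [unitary_zero, phaseZ_add]
  | d + 1, Φ => by
    rw [unitary_succ, unitary_succ, ← Fin.succ_last, tail_add_single_succ,
      unitary_add_single_last]
    simp [mul_assoc]

/-! ### The parameter-shift rule -/

/-- The factor $iZ$ produced by differentiation is itself $e^{i(\pi/2)Z}$, so it merges into the
phase. -/
theorem hasDerivAt_phaseZ_apply (α β t : ℝ) (a b : Fin 2) :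
    HasDerivAt (fun s : ℝ => phaseZ (α + s * β) a b)
      (((β : ℂ) • phaseZ (α + t * β + Real.pi / 2)) a b) t := by
  have hr : HasDerivAt (fun s : ℝ => ((α + s * β : ℝ) : ℂ)) (β : ℂ) t := by
    have : HasDerivAt (fun s : ℝ => α + s * β) β t := by
      simpa using ((hasDerivAt_id t).mul_const β).const_add α
    exact this.ofReal_comp
  have h1 := (hr.const_mul Complex.I).cexp
  have h2 := (hr.const_mul Complex.I).neg.cexp
  have e1 : Complex.exp (Real.pi / 2 * Complex.I) = Complex.I := Complex.exp_pi_div_two_mul_I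
  have k1 (r : ℝ) : Complex.exp (Complex.I * ((r + Real.pi / 2 : ℝ) : ℂ)) =
      Complex.exp (Complex.I * r) * Complex.I := by
    rw [← e1, ← Complex.exp_add, e1]; push_cast; ring_nf
  have k2 (r : ℝ) : Complex.exp (-(Complex.I * ((r + Real.pi / 2 : ℝ) : ℂ))) =
      Complex.exp (-(Complex.I * r)) * -Complex.I := by
    rw [Complex.exp_neg, k1, mul_inv, Complex.inv_I, Complex.exp_neg]
  simp only [phaseZ_eq]
  fin_cases a <;> fin_cases b
  · refine h1.congr_deriv ?_
    change _ = (β : ℂ) * Complex.exp (Complex.I * ((_ + Real.pi / 2 : ℝ) : ℂ))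
    rw [k1]
    ring
  · simpa using hasDerivAt_const t (0 : ℂ)
  · simpa using hasDerivAt_const t (0 : ℂ)
  · refine h2.congr_deriv ?_
    change _ = (β : ℂ) * Complex.exp (-(Complex.I * ((_ + Real.pi / 2 : ℝ) : ℂ)))
    rw [k2]
    change Complex.exp (-(Complex.I * _)) * _ = _
    ring

theorem hasDerivAt_matrix_mul_apply {l m n : Type*} [Fintype m] {A : ℝ → Matrix l m ℂ}
    {A' : Matrix l m ℂ} {B : ℝ → Matrix m n ℂ} {B' : Matrix m n ℂ} {t : ℝ}
    (hA : ∀ a b, HasDerivAt (fun s => A s a b) (A' a b) t)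
    (hB : ∀ a b, HasDerivAt (fun s => B s a b) (B' a b) t) (a : l) (b : n) :
    HasDerivAt (fun s => (A s * B s) a b) ((A' * B t + A t * B') a b) t := by
  simp only [Matrix.mul_apply, Matrix.add_apply, ← Finset.sum_add_distrib]
  exact HasDerivAt.fun_sum fun c _ => (hA a c).mul (hB c b)

theorem hasDerivAt_unitary_apply (x t : ℝ) : ∀ {d : ℕ} (Φ V : Fin (d + 1) → ℝ) (a b : Fin 2),
    HasDerivAt (fun s : ℝ => unitary x (Φ + s • V) a b)
      ((∑ j, (V j : ℂ) • unitary x (Φ + t • V + Pi.single j (Real.pi / 2))) a b) t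
  | 0, Φ, V, a, b => by
    simpa [unitary_zero] using hasDerivAt_phaseZ_apply (Φ 0) (V 0) t a b
  | d + 1, Φ, V, a, b => by
    have h1 := hasDerivAt_phaseZ_apply (Φ 0) (V 0) t
    have h2 := hasDerivAt_unitary_apply x t (Fin.tail Φ) (Fin.tail V)
    have h3 := hasDerivAt_matrix_mul_apply (A := fun _ => signalW x) (A' := 0)
      (fun _ _ => hasDerivAt_const t _) h2
    have h4 := hasDerivAt_matrix_mul_apply h1 h3 a b
    have ht (s : ℝ) : Fin.tail (Φ + s • V) = Fin.tail Φ + s • Fin.tail V := rfl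
    convert h4 using 1
    · funext s
      rw [unitary_succ, ht]
      simp
    · rw [Fin.sum_univ_succ]
      simp only [unitary_succ x (_ + Pi.single _ _), tail_add_single_zero, tail_add_single_succ,
        ht, zero_mul, zero_add, Matrix.mul_sum, Matrix.mul_smul, Matrix.smul_mul]
      simp [Fin.tail, (Fin.succ_ne_zero _).symm]

theorem hasDerivAt_g {d : ℕ} (x t : ℝ) (Φ V : Fin (d + 1) → ℝ) :
    HasDerivAt (fun s : ℝ => g x (Φ + s • V))
      (∑ j, V j * g x (Φ + t • V + Pi.single j (Real.pi / 2))) t := by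
  have h := Complex.reCLM.hasFDerivAt.comp_hasDerivAt t (hasDerivAt_unitary_apply x t Φ V 0 0)
  refine h.congr_deriv ?_
  simp [g, Matrix.sum_apply]

/-! ### The initial guess -/

theorem initialPhase_eq {d : ℕ} (hd : 1 ≤ d) :
    initialPhase d = 0 + Pi.single 0 (Real.pi / 4) + Pi.single (Fin.last d) (Real.pi / 4) := by
  have h0 : (0 : Fin (d + 1)) ≠ Fin.last d := by
    intro h
    have := congrArg Fin.val h
    simp at this
    omega
  funext i
  by_cases h1 : i = 0
  · subst h1
    simp [initialPhase, h0]
  · by_cases h2 : i = Fin.last d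
    · simp [initialPhase, h2, h0.symm]
    · simp [initialPhase, h1, h2]

theorem unitary_zero_phases (x : ℝ) : ∀ d : ℕ,
    unitary x (0 : Fin (d + 1) → ℝ) = rotX (d * Real.arccos x)
  | 0 => by simp [unitary_zero, phaseZ_zero, rotX_zero]
  | d + 1 => by
    have ht : Fin.tail (0 : Fin (d + 1 + 1) → ℝ) = 0 := rfl
    rw [unitary_succ, ht, unitary_zero_phases, signalW_eq, rotX_mul]
    simp only [Pi.zero_apply, phaseZ_zero, one_mul]
    push_cast
    ring_nf

theorem phaseZ_pi_div_two_mul_rotX (θ : ℝ) :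
    phaseZ (Real.pi / 2) * rotX θ = rotX (-θ) * phaseZ (Real.pi / 2) := by
  have e1 : Complex.exp (Complex.I * (Real.pi / 2)) = Complex.I := by
    rw [mul_comm, Complex.exp_pi_div_two_mul_I]
  ext i j
  fin_cases i <;> fin_cases j <;>
    simp [rotX, phaseZ_eq, Complex.exp_neg, e1, Matrix.mul_apply, Fin.sum_univ_two] <;> ring

/-- $e^{i(\pi/2)Z}=iZ$ anticommutes with $X$: pushed to the right end, it reverses the $d-j$
rotations it crosses, leaving the angle $j-(d-j)$ times $\arccos x$. -/
theorem unitary_single (x : ℝ) : ∀ {d : ℕ} (j : Fin (d + 1)),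
    unitary x (Pi.single j (Real.pi / 2) : Fin (d + 1) → ℝ) =
      rotX ((2 * (j : ℝ) - d) * Real.arccos x) * phaseZ (Real.pi / 2)
  | 0, j => by
    obtain rfl : j = 0 := Fin.fin_one_eq_zero j
    simp [unitary_zero, rotX_zero]
  | d + 1, j => by
    cases j using Fin.cases with
    | zero =>
      have := unitary_add_single_zero x (Real.pi / 2) (0 : Fin (d + 1 + 1) → ℝ)
      rw [zero_add] at this
      rw [this, unitary_zero_phases, phaseZ_pi_div_two_mul_rotX]
      push_cast
      simp only [Fin.val_zero]
      ring_nf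
    | succ i =>
      have ht := tail_add_single_succ (0 : Fin (d + 1 + 1) → ℝ) i (Real.pi / 2)
      have ht0 : Fin.tail (0 : Fin (d + 1 + 1) → ℝ) = 0 := rfl
      rw [ht0, zero_add, zero_add] at ht
      rw [unitary_succ, ht, unitary_single, signalW_eq, ← mul_assoc (rotX _), rotX_mul]
      simp only [Pi.single_apply, (Fin.succ_ne_zero _).symm, if_false, phaseZ_zero, one_mul,
        Fin.val_succ]
      push_cast
      ring_nf

theorem unitary_initialPhase_add {d : ℕ} (hd : 1 ≤ d) (x : ℝ) (Ψ : Fin (d + 1) → ℝ) :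
    unitary x (initialPhase d + Ψ) =
      phaseZ (Real.pi / 4) * unitary x Ψ * phaseZ (Real.pi / 4) := by
  have : initialPhase d + Ψ =
      Ψ + Pi.single 0 (Real.pi / 4) + Pi.single (Fin.last d) (Real.pi / 4) := by
    rw [initialPhase_eq hd]
    abel
  rw [this, unitary_add_single_last, unitary_add_single_zero]

/-- The two outer phases $\pi/4$ together multiply the upper-left entry by $i$. -/
theorem g_initialPhase_add {d : ℕ} (hd : 1 ≤ d) (x : ℝ) (Ψ : Fin (d + 1) → ℝ) :
    g x (initialPhase d + Ψ) = -(unitary x Ψ 0 0).im := by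
  have e : Complex.exp (Complex.I * (Real.pi / 4)) * Complex.exp (Complex.I * (Real.pi / 4)) =
      Complex.I := by
    rw [← Complex.exp_add]
    refine Eq.trans ?_ Complex.exp_pi_div_two_mul_I
    ring_nf
  have h : unitary x (initialPhase d + Ψ) 0 0 = Complex.I * unitary x Ψ 0 0 := by
    rw [unitary_initialPhase_add hd, ← e, phaseZ_eq, Matrix.mul_apply, Fin.sum_univ_two,
      Matrix.mul_apply, Fin.sum_univ_two]
    simp
    ring
  simp [g, h]

theorem g_initialPhase {d : ℕ} (hd : 1 ≤ d) (x : ℝ) : g x (initialPhase d) = 0 := by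
  have := g_initialPhase_add hd x 0
  rw [add_zero, unitary_zero_phases] at this
  rw [this, rotX]
  change -((Real.cos _ : ℝ) : ℂ).im = 0
  simp only [Complex.ofReal_im, neg_zero]

theorem g_initialPhase_add_single {d : ℕ} (hd : 1 ≤ d) (x : ℝ) (j : Fin (d + 1)) :
    g x (initialPhase d + Pi.single j (Real.pi / 2)) =
      -Real.cos ((2 * (j : ℝ) - d) * Real.arccos x) := by
  have e1 : Complex.exp (Complex.I * (Real.pi / 2)) = Complex.I := by
    rw [mul_comm, Complex.exp_pi_div_two_mul_I]
  rw [g_initialPhase_add hd, unitary_single]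
  generalize (2 * (j : ℝ) - d) * Real.arccos x = α
  simp [rotX, phaseZ_eq, Matrix.mul_apply, Fin.sum_univ_two, e1, -Complex.ofReal_cos]

/-! ### Discrete orthogonality at the nodes -/

theorem redLen_pos (d : ℕ) : 0 < redLen d := Nat.succ_pos _

theorem arccos_node {d k : ℕ} (hk : k ∈ Finset.Icc 1 (redLen d)) :
    Real.arccos (node d k) = (2 * (k : ℝ) - 1) / (4 * (redLen d : ℝ)) * Real.pi := by
  obtain ⟨h1, h2⟩ := Finset.mem_Icc.1 hk
  have h1' : (1 : ℝ) ≤ k := by exact_mod_cast h1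
  have h2' : (k : ℝ) ≤ redLen d := by exact_mod_cast h2
  apply Real.arccos_cos
  · have : 0 ≤ 2 * (k : ℝ) - 1 := by linarith
    positivity
  · apply mul_le_of_le_one_left Real.pi_pos.le
    rw [div_le_one (by linarith)]
    linarith

theorem two_mul_sin_mul_sum_cos (β : ℝ) (n : ℕ) :
    2 * Real.sin β * ∑ k ∈ Finset.Icc 1 n, Real.cos ((2 * (k : ℝ) - 1) * β) =
      Real.sin (2 * n * β) := by
  induction n with
  | zero => simp
  | succ n ih =>
    rw [Finset.sum_Icc_succ_top (by omega), mul_add, ih, Real.two_mul_sin_mul_cos]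
    push_cast
    rw [← sub_eq_zero]
    have e1 : β - (2 * ((n : ℝ) + 1) - 1) * β = -(2 * n * β) := by ring
    have e2 : β + (2 * ((n : ℝ) + 1) - 1) * β = 2 * (n + 1) * β := by ring
    rw [e1, e2, Real.sin_neg]
    ring

/-- With $\beta=m\pi/(2n)$ the telescoped sum is $\sin(m\pi)=0$, while $\sin\beta\ne0$ because
$2n\nmid m$. -/
theorem sum_cos_eq_zero {n : ℕ} {m : ℤ} (hm : m ≠ 0) (hmn : |m| < 2 * (n : ℤ)) :
    ∑ k ∈ Finset.Icc 1 n,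
      Real.cos (2 * (m : ℝ) * ((2 * (k : ℝ) - 1) / (4 * (n : ℝ)) * Real.pi)) = 0 := by
  have hn : (0 : ℝ) < n := by
    have : (0 : ℤ) < n := by
      have := abs_nonneg m
      omega
    exact_mod_cast this
  have h := two_mul_sin_mul_sum_cos (m * Real.pi / (2 * n)) n
  have e1 : 2 * (n : ℝ) * (m * Real.pi / (2 * n)) = m * Real.pi := by field_simp
  rw [e1, Real.sin_int_mul_pi] at h
  have hs : Real.sin (m * Real.pi / (2 * n)) ≠ 0 := by
    intro h0
    obtain ⟨l, hl⟩ := Real.sin_eq_zero_iff.1 h0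
    have hl' : (m : ℝ) = l * (2 * n) := by
      have := Real.pi_pos
      field_simp at hl
      linarith
    have hl2 : m = l * (2 * n) := by exact_mod_cast hl'
    have : (2 * (n : ℤ)) ∣ m := ⟨l, by rw [hl2]; ring⟩
    exact hm (Int.eq_zero_of_abs_lt_dvd this hmn)
  have h' := (mul_eq_zero.1 h).resolve_left (mul_ne_zero two_ne_zero hs)
  rw [← h']
  refine Finset.sum_congr rfl fun k _ => ?_
  congr 1
  field_simp
  ring

theorem sum_cos_nodes {d : ℕ} {m : ℤ} (hmn : |m| ≤ d) :
    ∑ k ∈ Finset.Icc 1 (redLen d), Real.cos (2 * (m : ℝ) * Real.arccos (node d k)) =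
      if m = 0 then (redLen d : ℝ) else 0 := by
  split_ifs with h
  · subst h
    simp
  · rw [← sum_cos_eq_zero h (n := redLen d) (by unfold redLen; omega)]
    exact Finset.sum_congr rfl fun k hk => by rw [arccos_node hk]

theorem sum_cos_mul_cos_nodes {d : ℕ} (i j : Fin (d + 1)) :
    ∑ k ∈ Finset.Icc 1 (redLen d), Real.cos ((2 * (i : ℝ) - d) * Real.arccos (node d k)) *
      Real.cos ((2 * (j : ℝ) - d) * Real.arccos (node d k)) =
      (redLen d : ℝ) / 2 * ((if i = j then 1 else 0) + if i.rev = j then 1 else 0) := by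
  have hi := i.isLt
  have hj := j.isLt
  have h1 := sum_cos_nodes (d := d) (m := (i : ℤ) - j) (by rw [abs_le]; omega)
  have h2 := sum_cos_nodes (d := d) (m := (i : ℤ) + j - d) (by rw [abs_le]; omega)
  have c1 : ((i : ℤ) - j = 0) ↔ i = j := by rw [Fin.ext_iff]; omega
  have c2 : ((i : ℤ) + j - d = 0) ↔ i.rev = j := by rw [Fin.ext_iff, Fin.val_rev]; omega
  simp only [c1, c2] at h1 h2
  have key : (redLen d : ℝ) / 2 * ((if i = j then 1 else 0) + if i.rev = j then 1 else 0) =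
      1 / 2 * ((if i = j then (redLen d : ℝ) else 0) + if i.rev = j then (redLen d : ℝ) else 0) := by
    split_ifs <;> ring
  rw [key, ← h1, ← h2, ← Finset.sum_add_distrib, Finset.mul_sum]
  refine Finset.sum_congr rfl fun k _ => ?_
  push_cast
  rw [← sub_eq_zero]
  generalize Real.arccos (node d k) = θ
  have e1 : 2 * ((i : ℝ) - j) * θ = (2 * (i : ℝ) - d) * θ - (2 * (j : ℝ) - d) * θ := by ring
  have e2 : 2 * ((i : ℝ) + j - d) * θ = (2 * (i : ℝ) - d) * θ + (2 * (j : ℝ) - d) * θ := by ring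
  rw [e1, e2, Real.cos_sub, Real.cos_add]
  ring

/-- The cosines for $j$ and $d-j$ coincide, so the Gram matrix is $\frac{\tilde d}2(I+R)$ with $R$
the index reversal. Symmetric vectors satisfy $RV=V$, which covers a middle index as well. -/
theorem sum_sq_sum_cos_nodes {d : ℕ} {V : Fin (d + 1) → ℝ} (hV : IsSymmetric V) :
    ∑ k ∈ Finset.Icc 1 (redLen d),
      (∑ j, V j * Real.cos ((2 * (j : ℝ) - d) * Real.arccos (node d k))) ^ 2 =
      redLen d * ∑ j, V j ^ 2 := by
  simp only [sq, Finset.sum_mul_sum]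
  rw [Finset.sum_comm]
  simp only [Finset.mul_sum]
  refine Finset.sum_congr rfl fun i _ => ?_
  rw [Finset.sum_comm]
  have (j : Fin (d + 1)) : ∑ k ∈ Finset.Icc 1 (redLen d),
      V i * Real.cos ((2 * (i : ℝ) - d) * Real.arccos (node d k)) *
        (V j * Real.cos ((2 * (j : ℝ) - d) * Real.arccos (node d k))) =
      (redLen d : ℝ) / 2 * V i * ((if i = j then V j else 0) + if i.rev = j then V j else 0) := by
    have h := sum_cos_mul_cos_nodes i j
    calc _ = V i * V j * ∑ k ∈ Finset.Icc 1 (redLen d),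
          Real.cos ((2 * (i : ℝ) - d) * Real.arccos (node d k)) *
            Real.cos ((2 * (j : ℝ) - d) * Real.arccos (node d k)) := by
          rw [Finset.mul_sum]
          exact Finset.sum_congr rfl fun k _ => by ring
      _ = _ := by
          rw [h]
          split_ifs <;> ring
  simp only [this, ← Finset.mul_sum, Finset.sum_add_distrib, Finset.sum_ite_eq, Finset.mem_univ,
    if_true]
  rw [hV i]
  ring

/-! ### Directional derivatives -/

/-- The derivative of `g x` at `Φ` in the direction `V`. -/
noncomputable def dirDeriv {d : ℕ} (x : ℝ) (V Φ : Fin (d + 1) → ℝ) : ℝ :=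
  ∑ j, V j * g x (Φ + Pi.single j (Real.pi / 2))

/-- The second derivative of `g x` at `Φ` in the directions `V` and `W`. -/
noncomputable def dirDeriv₂ {d : ℕ} (x : ℝ) (V W Φ : Fin (d + 1) → ℝ) : ℝ :=
  ∑ i, V i * dirDeriv x W (Φ + Pi.single i (Real.pi / 2))

theorem hasDerivAt_dirDeriv {d : ℕ} (x t : ℝ) (Φ V W : Fin (d + 1) → ℝ) :
    HasDerivAt (fun s : ℝ => dirDeriv x V (Φ + s • W)) (dirDeriv₂ x V W (Φ + t • W)) t := by
  refine HasDerivAt.fun_sum fun i _ => ?_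
  have h := (hasDerivAt_g x t (Φ + Pi.single i (Real.pi / 2)) W).const_mul (V i)
  simp only [add_right_comm Φ] at h ⊢
  exact h

theorem abs_dirDeriv_le {d : ℕ} (x : ℝ) (V Φ : Fin (d + 1) → ℝ) :
    |dirDeriv x V Φ| ≤ ∑ j, |V j| := by
  refine (Finset.abs_sum_le_sum_abs _ _).trans (Finset.sum_le_sum fun j _ => ?_)
  rw [abs_mul]
  exact mul_le_of_le_one_right (abs_nonneg _) (abs_g_le_one _ _)

theorem abs_dirDeriv₂_le {d : ℕ} (x : ℝ) (V W Φ : Fin (d + 1) → ℝ) :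
    |dirDeriv₂ x V W Φ| ≤ (∑ j, |V j|) * ∑ j, |W j| := by
  rw [Finset.sum_mul]
  refine (Finset.abs_sum_le_sum_abs _ _).trans (Finset.sum_le_sum fun j _ => ?_)
  rw [abs_mul]
  exact mul_le_mul_of_nonneg_left (abs_dirDeriv_le _ _ _) (abs_nonneg _)

theorem dirDeriv_sum_smul {d : ℕ} {ι : Type*} [Fintype ι] (x : ℝ) (c : ι → ℝ)
    (E : ι → Fin (d + 1) → ℝ) (Φ : Fin (d + 1) → ℝ) :
    dirDeriv x (∑ i, c i • E i) Φ = ∑ i, c i * dirDeriv x (E i) Φ := by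
  simp only [dirDeriv, Finset.sum_apply, Pi.smul_apply, smul_eq_mul, Finset.sum_mul,
    Finset.mul_sum]
  rw [Finset.sum_comm]
  simp only [mul_assoc]

theorem dirDeriv₂_comm {d : ℕ} (x : ℝ) (V W Φ : Fin (d + 1) → ℝ) :
    dirDeriv₂ x V W Φ = dirDeriv₂ x W V Φ := by
  simp only [dirDeriv₂, dirDeriv, Finset.mul_sum]
  rw [Finset.sum_comm]
  refine Finset.sum_congr rfl fun i _ => Finset.sum_congr rfl fun j _ => ?_
  rw [add_right_comm, mul_left_comm]

theorem dirDeriv₂_sum_smul_left {d : ℕ} {ι : Type*} [Fintype ι] (x : ℝ) (c : ι → ℝ)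
    (E : ι → Fin (d + 1) → ℝ) (W Φ : Fin (d + 1) → ℝ) :
    dirDeriv₂ x (∑ i, c i • E i) W Φ = ∑ i, c i * dirDeriv₂ x (E i) W Φ := by
  simp only [dirDeriv₂, Finset.sum_apply, Pi.smul_apply, smul_eq_mul, Finset.sum_mul,
    Finset.mul_sum]
  rw [Finset.sum_comm]
  simp only [mul_assoc]

theorem dirDeriv₂_sum_smul_right {d : ℕ} {ι : Type*} [Fintype ι] (x : ℝ) (c : ι → ℝ)
    (E : ι → Fin (d + 1) → ℝ) (V Φ : Fin (d + 1) → ℝ) :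
    dirDeriv₂ x V (∑ i, c i • E i) Φ = ∑ i, c i * dirDeriv₂ x V (E i) Φ := by
  simp only [dirDeriv₂_comm x V, dirDeriv₂_sum_smul_left]

theorem abs_dirDeriv_add_sub_le {d : ℕ} (x : ℝ) (V W Φ : Fin (d + 1) → ℝ) :
    |dirDeriv x V (Φ + W) - dirDeriv x V Φ| ≤ (∑ j, |V j|) * ∑ j, |W j| := by
  have h := norm_image_sub_le_of_norm_deriv_le_segment_01' (C := (∑ j, |V j|) * ∑ j, |W j|)
    (fun t _ => (hasDerivAt_dirDeriv x t Φ V W).hasDerivWithinAt)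
    (fun t _ => abs_dirDeriv₂_le x V W _)
  simpa using h

/-- Mean value inequality for $t\mapsto g(\Phi+tW)-t\,D_Wg(\Phi)$; the sharper Taylor factor $1/2$
is not needed. -/
theorem abs_g_add_sub_sub_le {d : ℕ} (x : ℝ) (W Φ : Fin (d + 1) → ℝ) :
    |g x (Φ + W) - g x Φ - dirDeriv x W Φ| ≤ (∑ j, |W j|) ^ 2 := by
  have h := norm_image_sub_le_of_norm_deriv_le_segment_01' (C := (∑ j, |W j|) ^ 2)
    (f := fun t : ℝ => g x (Φ + t • W) - t * dirDeriv x W Φ)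
    (f' := fun t => dirDeriv x W (Φ + t • W) - dirDeriv x W Φ)
    (fun t _ => (((hasDerivAt_g x t Φ W).sub
      (by simpa using (hasDerivAt_id t).mul_const (dirDeriv x W Φ)))).hasDerivWithinAt)
    (fun t ht => by
      refine (abs_dirDeriv_add_sub_le x W (t • W) Φ).trans ?_
      rw [sq]
      refine mul_le_mul_of_nonneg_left (Finset.sum_le_sum fun j _ => ?_)
        (Finset.sum_nonneg fun j _ => abs_nonneg _)
      rw [Pi.smul_apply, smul_eq_mul, abs_mul, abs_of_nonneg ht.1]
      exact mul_le_of_le_one_left (abs_nonneg _) ht.2.le)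
  simpa [sub_right_comm] using h

/-! ### Reduced and full phase factors -/

theorem unreduced_add_smul {d : ℕ} (φ v : EuclideanSpace ℝ (Fin (redLen d))) (t : ℝ) :
    unreduced (d := d) (φ + t • v) = unreduced φ + t • unreduced v := rfl

theorem unreduced_sub {d : ℕ} (φ v : EuclideanSpace ℝ (Fin (redLen d))) :
    unreduced (d := d) (φ - v) = unreduced φ - unreduced v := rfl

theorem isSymmetric_unreduced {d : ℕ} (v : EuclideanSpace ℝ (Fin (redLen d))) :
    IsSymmetric (unreduced (d := d) v) := by
  intro i
  have hi := i.isLt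
  refine congrArg v.ofLp (Fin.ext ?_)
  simp only [Fin.val_rev]
  omega

theorem isSymmetric_initialPhase (d : ℕ) : IsSymmetric (initialPhase d) := by
  intro i
  unfold initialPhase
  congr 1
  rw [Fin.rev_eq_iff, Fin.rev_eq_iff]
  simp [or_comm]

theorem unreduced_eq_sum {d : ℕ} (v : EuclideanSpace ℝ (Fin (redLen d))) :
    unreduced (d := d) v = ∑ i, v i • unreduced (EuclideanSpace.single i (1 : ℝ)) := by
  funext j
  simp [unreduced, Finset.sum_apply]

theorem norm_sq_le_sum_sq_unreduced {d : ℕ} (v : EuclideanSpace ℝ (Fin (redLen d))) :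
    ‖v‖ ^ 2 ≤ ∑ j, unreduced (d := d) v j ^ 2 := by
  rw [EuclideanSpace.real_norm_sq_eq]
  let e : Fin (redLen d) ↪ Fin (d + 1) :=
    ⟨fun i => ⟨i, lt_of_redLen i.isLt⟩, fun a b h => by
      rw [Fin.ext_iff] at h ⊢; exact h⟩
  have h : ∀ i, v i = unreduced (d := d) v (e i) := by
    intro i
    have hi : (i : ℕ) < d / 2 + 1 := i.isLt
    refine congrArg v.ofLp (Fin.ext ?_)
    change (i : ℕ) = min (i : ℕ) (d - i)
    omega
  calc ∑ i, v i ^ 2 = ∑ j ∈ Finset.univ.map e, unreduced (d := d) v j ^ 2 := by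
        rw [Finset.sum_map]
        exact Finset.sum_congr rfl fun i _ => by rw [h]
    _ ≤ _ := Finset.sum_le_univ_sum_of_nonneg fun j => sq_nonneg _

theorem sum_sq_unreduced_le {d : ℕ} (v : EuclideanSpace ℝ (Fin (redLen d))) :
    ∑ j, unreduced (d := d) v j ^ 2 ≤ 2 * ‖v‖ ^ 2 := by
  rw [EuclideanSpace.real_norm_sq_eq]
  let r : Fin (d + 1) → Fin (redLen d) := fun j => ⟨min (j : ℕ) (d - j), min_lt_redLen j⟩
  rw [← Finset.sum_fiberwise Finset.univ r, Finset.mul_sum]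
  refine Finset.sum_le_sum fun i _ => ?_
  have hi : (i : ℕ) < d / 2 + 1 := i.isLt
  -- A reduced coordinate occurs only at positions $i$ and $d-i$, whence the factor 2.
  have hsub : (Finset.univ.filter fun j => r j = i) ⊆
      {⟨i, lt_of_redLen i.isLt⟩, ⟨d - i, by omega⟩} := by
    intro j hj
    have hj2 := congrArg Fin.val (Finset.mem_filter.1 hj).2
    have hj3 := j.isLt
    simp only [r] at hj2
    simp only [Finset.mem_insert, Finset.mem_singleton, Fin.ext_iff]
    omega
  have hcard := (Finset.card_le_card hsub).trans Finset.card_le_two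
  calc ∑ j ∈ Finset.univ.filter (fun j => r j = i), unreduced (d := d) v j ^ 2
      = ∑ j ∈ Finset.univ.filter (fun j => r j = i), v i ^ 2 :=
        Finset.sum_congr rfl fun j hj => by rw [← (Finset.mem_filter.1 hj).2]; rfl
    _ = (Finset.univ.filter fun j => r j = i).card * v i ^ 2 := by simp
    _ ≤ 2 * v i ^ 2 := by
        have : ((Finset.univ.filter fun j => r j = i).card : ℝ) ≤ 2 := Nat.cast_le_ofNat.2 hcard
        gcongr

/-- Cauchy–Schwarz over $d+1\le2\tilde d$ indices; the other factor 2 comes from the duplicated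
coordinates. -/
theorem sum_abs_unreduced_sq_le {d : ℕ} (v : EuclideanSpace ℝ (Fin (redLen d))) :
    (∑ j, |unreduced (d := d) v j|) ^ 2 ≤ 4 * redLen d * ‖v‖ ^ 2 := by
  have h1 := sq_sum_le_card_mul_sum_sq (s := Finset.univ) (f := fun j => |unreduced (d := d) v j|)
  simp only [sq_abs, Finset.card_univ, Fintype.card_fin] at h1
  have h2 := sum_sq_unreduced_le v
  have h3 : ((d + 1 : ℕ) : ℝ) ≤ 2 * redLen d := by
    have : d + 1 ≤ 2 * redLen d := by unfold redLen; omega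
    exact_mod_cast this
  have h4 : 0 ≤ ∑ j, unreduced (d := d) v j ^ 2 := Finset.sum_nonneg fun j _ => sq_nonneg _
  calc _ ≤ _ := h1
    _ ≤ 2 * redLen d * ∑ j, unreduced (d := d) v j ^ 2 := by gcongr
    _ ≤ 2 * redLen d * (2 * ‖v‖ ^ 2) := by gcongr
    _ = _ := by ring

/-! ### The Hessian of the cost function -/

theorem partialDeriv_cost {d : ℕ} (f : ℝ[X]) (i : Fin (redLen d))
    (φ : EuclideanSpace ℝ (Fin (redLen d))) :
    partialDeriv i (cost (d := d) f) φ = 1 / (redLen d : ℝ) * ∑ k ∈ Finset.Icc 1 (redLen d),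
      2 * ((g (node d k) (unreduced φ) - f.eval (node d k)) *
        dirDeriv (node d k) (unreduced (EuclideanSpace.single i (1 : ℝ))) (unreduced φ)) := by
  refine HasDerivAt.deriv ?_
  simp only [cost, fullCost, unreduced_add_smul, sq_abs]
  refine HasDerivAt.const_mul _ (HasDerivAt.fun_sum fun k _ => ?_)
  have h := ((hasDerivAt_g (node d k) 0 (unreduced φ)
    (unreduced (EuclideanSpace.single i (1 : ℝ)))).sub_const (f.eval (node d k))).pow 2
  refine h.congr_deriv ?_
  simp [dirDeriv, mul_assoc]

theorem hessian_cost_apply {d : ℕ} (f : ℝ[X]) (φ : EuclideanSpace ℝ (Fin (redLen d)))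
    (i j : Fin (redLen d)) :
    hessian (cost (d := d) f) φ i j = 1 / (redLen d : ℝ) * ∑ k ∈ Finset.Icc 1 (redLen d),
      2 * (dirDeriv (node d k) (unreduced (EuclideanSpace.single i (1 : ℝ))) (unreduced φ) *
          dirDeriv (node d k) (unreduced (EuclideanSpace.single j (1 : ℝ))) (unreduced φ) +
        (g (node d k) (unreduced φ) - f.eval (node d k)) *
          dirDeriv₂ (node d k) (unreduced (EuclideanSpace.single i (1 : ℝ)))
            (unreduced (EuclideanSpace.single j (1 : ℝ))) (unreduced φ)) := by
  rw [hessian, Matrix.of_apply, funext (partialDeriv_cost f i)]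
  refine HasDerivAt.deriv ?_
  simp only [unreduced_add_smul]
  refine HasDerivAt.const_mul _ (HasDerivAt.fun_sum fun k _ => HasDerivAt.const_mul _ ?_)
  have h := ((hasDerivAt_g (node d k) 0 (unreduced φ)
    (unreduced (EuclideanSpace.single j (1 : ℝ)))).sub_const (f.eval (node d k))).mul
    (hasDerivAt_dirDeriv (node d k) 0 (unreduced φ)
      (unreduced (EuclideanSpace.single i (1 : ℝ))) (unreduced (EuclideanSpace.single j (1 : ℝ))))
  refine h.congr_deriv ?_
  simp only [zero_smul, add_zero]
  rw [← dirDeriv]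
  ring

theorem isHermitian_hessian_cost {d : ℕ} (f : ℝ[X]) (φ : EuclideanSpace ℝ (Fin (redLen d))) :
    (hessian (cost (d := d) f) φ).IsHermitian := by
  refine Matrix.IsHermitian.ext fun i j => ?_
  simp only [star_trivial, hessian_cost_apply]
  congr 1
  refine Finset.sum_congr rfl fun k _ => ?_
  rw [dirDeriv₂_comm]
  ring

theorem hessian_cost_quadForm {d : ℕ} (f : ℝ[X]) (φ v : EuclideanSpace ℝ (Fin (redLen d))) :
    v.ofLp ⬝ᵥ (hessian (cost (d := d) f) φ).mulVec v.ofLp =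
      1 / (redLen d : ℝ) * ∑ k ∈ Finset.Icc 1 (redLen d),
        2 * (dirDeriv (node d k) (unreduced v) (unreduced φ) ^ 2 +
          (g (node d k) (unreduced φ) - f.eval (node d k)) *
            dirDeriv₂ (node d k) (unreduced v) (unreduced v) (unreduced φ)) := by
  simp only [dotProduct, Matrix.mulVec, hessian_cost_apply]
  simp only [Finset.mul_sum, Finset.sum_mul]
  rw [Finset.sum_congr rfl fun i _ => Finset.sum_comm, Finset.sum_comm]
  refine Finset.sum_congr rfl fun k _ => ?_
  rw [unreduced_eq_sum v]
  simp only [dirDeriv_sum_smul, dirDeriv₂_sum_smul_left]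
  simp only [dirDeriv₂_sum_smul_right]
  simp only [sq, Finset.sum_mul_sum]
  simp only [Finset.mul_sum, ← Finset.sum_add_distrib]
  refine Finset.sum_congr rfl fun i _ => Finset.sum_congr rfl fun j _ => ?_
  ring

/-! ### Estimates near the initial guess -/

theorem dirDeriv_initialPhase {d : ℕ} (hd : 1 ≤ d) (x : ℝ) (V : Fin (d + 1) → ℝ) :
    dirDeriv x V (initialPhase d) =
      -∑ j, V j * Real.cos ((2 * (j : ℝ) - d) * Real.arccos x) := by
  simp [dirDeriv, g_initialPhase_add_single hd]

theorem sum_sq_dirDeriv_initialPhase {d : ℕ} (hd : 1 ≤ d) {V : Fin (d + 1) → ℝ}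
    (hV : IsSymmetric V) :
    ∑ k ∈ Finset.Icc 1 (redLen d), dirDeriv (node d k) V (initialPhase d) ^ 2 =
      redLen d * ∑ j, V j ^ 2 := by
  simp only [dirDeriv_initialPhase hd, neg_sq]
  exact sum_sq_sum_cos_nodes hV

theorem abs_eval_le_maxNorm (f : ℝ[X]) {x : ℝ} (hx : x ∈ Set.Icc (-1 : ℝ) 1) :
    |f.eval x| ≤ maxNorm f := by
  refine le_csSup ?_ ⟨x, hx, rfl⟩
  exact (isCompact_Icc.image_of_continuousOn (by fun_prop)).bddAbove

theorem sum_abs_g_sub_eval_le {d : ℕ} (hd : 1 ≤ d) (f : ℝ[X])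
    (hf : maxNorm f ≤ Real.sqrt 3 / (20 * Real.pi * (redLen d : ℝ)))
    (δ : EuclideanSpace ℝ (Fin (redLen d))) (hδ : ‖δ‖ ≤ 1 / (20 * (redLen d : ℝ))) :
    ∑ k ∈ Finset.Icc 1 (redLen d),
      |g (node d k) (initialPhase d + unreduced δ) - f.eval (node d k)| ≤ 121 / 1000 := by
  set n : ℝ := (redLen d : ℝ) with hn
  have hn0 : 0 < n := Nat.cast_pos.2 (redLen_pos d)
  set V := unreduced (d := d) δ
  have hδ2 : ‖δ‖ ^ 2 ≤ 1 / (400 * n ^ 2) := by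
    calc ‖δ‖ ^ 2 ≤ (1 / (20 * n)) ^ 2 := by gcongr
      _ = _ := by rw [div_pow, mul_pow]; norm_num
  have hL : (∑ j, |V j|) ^ 2 ≤ 1 / 100 / n := by
    calc _ ≤ 4 * n * ‖δ‖ ^ 2 := sum_abs_unreduced_sq_le δ
      _ ≤ 4 * n * (1 / (400 * n ^ 2)) := by gcongr
      _ = _ := by field_simp; norm_num
  have hF : maxNorm f ≤ 28 / 1000 / n := by
    refine hf.trans ?_
    rw [← div_div]
    refine div_le_div_of_nonneg_right ?_ hn0.le
    have h1 : Real.sqrt 3 ≤ 1.7321 := Real.sqrt_le_iff.2 (by norm_num)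
    have h2 := Real.pi_gt_d2
    rw [div_le_iff₀ (by positivity)]
    linarith
  -- Since $g$ vanishes at $\Phi^0$, the residual is the linear term, the Taylor remainder and $-f$.
  have hterm (k : ℕ) : |g (node d k) (initialPhase d + V) - f.eval (node d k)| ≤
      |dirDeriv (node d k) V (initialPhase d)| + (1 / 100 / n + 28 / 1000 / n) := by
    have h1 := (abs_g_add_sub_sub_le (node d k) V (initialPhase d)).trans hL
    have h2 := (abs_eval_le_maxNorm f
      (x := node d k) ⟨Real.neg_one_le_cos _, Real.cos_le_one _⟩).trans hF
    rw [g_initialPhase hd, sub_zero] at h1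
    have h3 := abs_add_three (dirDeriv (node d k) V (initialPhase d))
      (g (node d k) (initialPhase d + V) - dirDeriv (node d k) V (initialPhase d))
      (-f.eval (node d k))
    rw [abs_neg] at h3
    have e : dirDeriv (node d k) V (initialPhase d) +
      (g (node d k) (initialPhase d + V) - dirDeriv (node d k) V (initialPhase d)) +
      -f.eval (node d k) = g (node d k) (initialPhase d + V) - f.eval (node d k) := by ring
    rw [e] at h3
    linarith
  -- Cauchy–Schwarz and orthogonality bound the square by $1/200$; $71/1000$ is its root rounded up.
  have hp : ∑ k ∈ Finset.Icc 1 (redLen d), |dirDeriv (node d k) V (initialPhase d)| ≤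
      71 / 1000 := by
    refine abs_le_of_sq_le_sq' ?_ (by norm_num) |>.2
    have h1 := sq_sum_le_card_mul_sum_sq (s := Finset.Icc 1 (redLen d))
      (f := fun k => |dirDeriv (node d k) V (initialPhase d)|)
    simp only [sq_abs, Nat.card_Icc, Nat.add_sub_cancel] at h1
    rw [sum_sq_dirDeriv_initialPhase hd (isSymmetric_unreduced δ), ← hn] at h1
    calc _ ≤ _ := h1
      _ ≤ n * (n * (2 * ‖δ‖ ^ 2)) := by
        gcongr
        exact sum_sq_unreduced_le δ
      _ ≤ n * (n * (2 * (1 / (400 * n ^ 2)))) := by gcongr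
      _ = 1 / 200 := by field_simp; norm_num
      _ ≤ _ := by norm_num
  calc _ ≤ _ := Finset.sum_le_sum fun k _ => hterm k
    _ = ∑ k ∈ Finset.Icc 1 (redLen d), |dirDeriv (node d k) V (initialPhase d)| +
        n * (1 / 100 / n + 28 / 1000 / n) := by
          simp [Finset.sum_add_distrib, hn, mul_add]
    _ = ∑ k ∈ Finset.Icc 1 (redLen d), |dirDeriv (node d k) V (initialPhase d)| +
        38 / 1000 := by congr 1; field_simp; norm_num
    _ ≤ _ := by linarith

theorem hessian_cost_quadForm_bounds {d : ℕ} (hd : 1 ≤ d) (f : ℝ[X])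
    (hf : maxNorm f ≤ Real.sqrt 3 / (20 * Real.pi * (redLen d : ℝ)))
    (φ δ v : EuclideanSpace ℝ (Fin (redLen d)))
    (hφ : unreduced (d := d) φ = initialPhase d + unreduced δ)
    (hδ : ‖δ‖ ≤ 1 / (20 * (redLen d : ℝ))) (hv : ‖v‖ = 1) :
    1 / 4 ≤ v.ofLp ⬝ᵥ (hessian (cost (d := d) f) φ).mulVec v.ofLp ∧
      v.ofLp ⬝ᵥ (hessian (cost (d := d) f) φ).mulVec v.ofLp ≤ 25 / 4 := by
  rw [hessian_cost_quadForm, hφ]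
  have hR := sum_abs_g_sub_eval_le hd f hf δ hδ
  set n : ℝ := (redLen d : ℝ) with hn
  have hn0 : 0 < n := Nat.cast_pos.2 (redLen_pos d)
  set V := unreduced (d := d) v
  set W := unreduced (d := d) δ
  have hS1 : 1 ≤ ∑ j, V j ^ 2 := by simpa [hv] using norm_sq_le_sum_sq_unreduced v
  have hS2 : ∑ j, V j ^ 2 ≤ 2 := by simpa [hv] using sum_sq_unreduced_le v
  have hV : (∑ j, |V j|) ^ 2 ≤ 4 * n := by simpa [hv] using sum_abs_unreduced_sq_le v
  have hW : (∑ j, |W j|) ^ 2 ≤ 1 / 100 / n := by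
    calc _ ≤ 4 * n * ‖δ‖ ^ 2 := sum_abs_unreduced_sq_le δ
      _ ≤ 4 * n * (1 / (20 * n)) ^ 2 := by gcongr
      _ = _ := by field_simp; norm_num
  have hVW : ((∑ j, |V j|) * ∑ j, |W j|) ^ 2 ≤ 1 / 25 := by
    rw [mul_pow]
    calc _ ≤ 4 * n * (1 / 100 / n) := by gcongr
      _ = _ := by field_simp; norm_num
  have hP := sum_sq_dirDeriv_initialPhase hd (isSymmetric_unreduced v)
  rw [← hn] at hP
  set p : ℕ → ℝ := fun k => dirDeriv (node d k) V (initialPhase d)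
  set q : ℕ → ℝ := fun k => dirDeriv (node d k) V (initialPhase d + W) with hq
  set r : ℕ → ℝ := fun k => (g (node d k) (initialPhase d + W) - f.eval (node d k)) *
    dirDeriv₂ (node d k) V V (initialPhase d + W) with hr
  have hqp (k : ℕ) : (q k - p k) ^ 2 ≤ 1 / 25 :=
    (sq_le_sq' (abs_le.1 (abs_dirDeriv_add_sub_le (node d k) V W (initialPhase d))).1
      (abs_le.1 (abs_dirDeriv_add_sub_le (node d k) V W (initialPhase d))).2).trans hVW
  -- Young's inequality with weight $1/5$: with $e=q-p$, $\frac45p^2-4e^2\le q^2\le\frac65p^2+6e^2$,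
  -- and $e^2\le\frac1{25}$.
  have hlow : n * (4 / 5 * ∑ j, V j ^ 2 - 4 / 25) ≤ ∑ k ∈ Finset.Icc 1 (redLen d), q k ^ 2 := by
    calc _ = ∑ k ∈ Finset.Icc 1 (redLen d), (4 / 5 * p k ^ 2 - 4 / 25) := by
          rw [Finset.sum_sub_distrib, ← Finset.mul_sum, hP]
          simp [← hn]
          ring
      _ ≤ _ := Finset.sum_le_sum fun k _ => by
          nlinarith [hqp k, sq_nonneg (p k + 5 * (q k - p k))]
  have hup : ∑ k ∈ Finset.Icc 1 (redLen d), q k ^ 2 ≤ n * (6 / 5 * ∑ j, V j ^ 2 + 6 / 25) := by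
    calc _ ≤ ∑ k ∈ Finset.Icc 1 (redLen d), (6 / 5 * p k ^ 2 + 6 / 25) :=
          Finset.sum_le_sum fun k _ => by
            nlinarith [hqp k, sq_nonneg (p k - 5 * (q k - p k))]
      _ = _ := by
          rw [Finset.sum_add_distrib, ← Finset.mul_sum, hP]
          simp [← hn]
          ring
  have hrs : |∑ k ∈ Finset.Icc 1 (redLen d), r k| ≤ n * (484 / 1000) := by
    calc _ ≤ ∑ k ∈ Finset.Icc 1 (redLen d), |r k| := Finset.abs_sum_le_sum_abs _ _
      _ ≤ ∑ k ∈ Finset.Icc 1 (redLen d),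
          |g (node d k) (initialPhase d + W) - f.eval (node d k)| * (4 * n) :=
          Finset.sum_le_sum fun k _ => by
            rw [hr, abs_mul]
            refine mul_le_mul_of_nonneg_left ?_ (abs_nonneg _)
            refine (abs_dirDeriv₂_le _ _ _ _).trans ?_
            rwa [← sq]
      _ ≤ 121 / 1000 * (4 * n) := by
          rw [← Finset.sum_mul]
          gcongr
      _ = _ := by ring
  have hsum : 1 / n * ∑ k ∈ Finset.Icc 1 (redLen d), 2 * (q k ^ 2 + r k) =
      2 * (∑ k ∈ Finset.Icc 1 (redLen d), q k ^ 2 + ∑ k ∈ Finset.Icc 1 (redLen d), r k) / n := by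
    rw [← Finset.mul_sum, Finset.sum_add_distrib]
    ring
  have hrs' := abs_le.1 hrs
  change 1 / 4 ≤ 1 / n * ∑ k ∈ Finset.Icc 1 (redLen d), 2 * (q k ^ 2 + r k) ∧
    1 / n * ∑ k ∈ Finset.Icc 1 (redLen d), 2 * (q k ^ 2 + r k) ≤ 25 / 4
  rw [hsum, le_div_iff₀ hn0, div_le_iff₀ hn0]
  have h1 := mul_le_mul_of_nonneg_left hS1 hn0.le
  have h2 := mul_le_mul_of_nonneg_left hS2 hn0.le
  -- The margins are $2(\frac45-\frac4{25}-0.484)=0.312$ and $2(\frac{12}5+\frac6{25}+0.484)=6.248$.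
  constructor <;> linarith

end SymmetricQSP

theorem theorem4 (d : ℕ) (hd : 1 ≤ d) (f : Polynomial ℝ) (hf : SymmetricQSP.IsTarget d f)
    (hf_small : SymmetricQSP.maxNorm f ≤
      Real.sqrt 3 / (20 * Real.pi * (SymmetricQSP.redLen d : ℝ)))
    (Φ : Fin (d + 1) → ℝ) (hsymm : SymmetricQSP.IsSymmetric Φ)
    (hball : ‖SymmetricQSP.reduced Φ - SymmetricQSP.reduced (SymmetricQSP.initialPhase d)‖ ≤
      1 / (20 * (SymmetricQSP.redLen d : ℝ))) :
    ∃ hH : (SymmetricQSP.hessian (SymmetricQSP.cost (d := d) f)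
        (SymmetricQSP.reduced Φ)).IsHermitian,
      1 / 4 ≤ SymmetricQSP.lambdaMin hH ∧
      SymmetricQSP.lambdaMin hH ≤ SymmetricQSP.lambdaMax hH ∧
      SymmetricQSP.lambdaMax hH ≤ 25 / 4 := by
  have hH := SymmetricQSP.isHermitian_hessian_cost (d := d) f (SymmetricQSP.reduced Φ)
  have hφ : SymmetricQSP.unreduced (SymmetricQSP.reduced Φ) = SymmetricQSP.initialPhase d +
      SymmetricQSP.unreduced
        (SymmetricQSP.reduced Φ - SymmetricQSP.reduced (SymmetricQSP.initialPhase d)) := by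
    rw [SymmetricQSP.unreduced_sub, SymmetricQSP.unreduced_reduced hsymm,
      SymmetricQSP.unreduced_reduced (SymmetricQSP.isSymmetric_initialPhase d), add_sub_cancel]
  have hbounds (i : Fin (SymmetricQSP.redLen d)) :
      1 / 4 ≤ hH.eigenvalues i ∧ hH.eigenvalues i ≤ 25 / 4 := by
    have h := SymmetricQSP.hessian_cost_quadForm_bounds hd f hf_small _ _
      (hH.eigenvectorBasis i) hφ hball (hH.eigenvectorBasis.orthonormal.1 i)
    -- An eigenvalue is the quadratic form at its unit eigenvector.
    rw [hH.eigenvalues_eq i]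
    simpa using h
  -- Over an empty index type the real infimum would default to 0.
  have : Nonempty (Fin (SymmetricQSP.redLen d)) := ⟨⟨0, SymmetricQSP.redLen_pos d⟩⟩
  exact ⟨hH, le_ciInf fun i => (hbounds i).1,
    ciInf_le_ciSup (Set.finite_range _).bddBelow (Set.finite_range _).bddAbove,
    ciSup_le fun i => (hbounds i).2⟩
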